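/- Let $\Sigma:\ \dot x=Ax+Bu,\ y=Cx$ be an asymptotically stable continuous-time linear time-invariant system with real matrices $A\in\mathbb R^{n\times n}$, $B\in\mathbb R^{n\times m}$, $C\in\mathbb R^{q\times n}$. Let $W\in\mathbb R^{n\times n}$ be invertible and let $\bar A=W^{-1}AW$, $\bar B=W^{-1}B$, $\bar C=CW$ be the system matrices in the coordinates $\bar x=W^{-1}x$. Let $\Lambda=\mathrm{diag}\{\sigma_1,\dots,\sigma_n\}$ with all $\sigma_i>0$. Suppose that this realization is extended balanced, in the following sense: there are symmetric positive definite matrices $\bar Q,\bar P\in\mathbb R^{n\times n}$ and numbers $\alpha>0$, $\beta\ge 0$ with $\alpha=\beta$ such that $(\bar Q,\Lambda,\alpha)$ is an extended observability Gramian, i.e. $$\begin{bmatrix} -\bar Q\bar A-\bar A^\top\bar Q-\bar C^\top\bar C & \bar Q-(\alpha I+\bar A)^\top\Lambda\\ \bar Q-\Lambda(\alpha I+\bar A) & 2\Lambda\end{bmatrix}\ge 0,$$ and $(\bar P,\Lambda^{-1},\beta)$ is an inverse extended controllability Gramian, i.e. $$\begin{bmatrix} -\bar P\bar A-\bar A^\top\bar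 P & -\bar P+(\beta I+\bar A)^\top\Lambda^{-1} & -2\bar P\bar B\\ -\bar P+\Lambda^{-1}(\beta I+\bar A) & 2\Lambda^{-1} & 2\Lambda^{-1}\bar B\\ -2\bar B^\top\bar P & 2\bar B^\top\Lambda^{-1} & 4I_m\end{bmatrix}\ge 0 .$$ For $0\le k\le n$ let $\widehat\Sigma:\ \dot{\hat x}=\bar A_{11}\hat x+\bar B_1u,\ \hat y=\bar C_1\hat x$ be the truncated $k$-th order system, where $\bar A_{11}$ is the leading $k\times k$ block of $\bar A$, $\bar B_1$ consists of the first $k$ rows of $\bar B$ and $\bar C_1$ of the first $k$ columns of $\bar C$. Then $$\|\Sigma-\widehat\Sigma\|_\infty\le 2\sum_{j=k+1}^n\sigma_j .$$ Here $\Sigma-\widehat\Sigma$ is the system with input $u$ and output $y-\hat y$, and the bound holds both when $\|\cdot\|_\infty$ is read as the $H_\infty$ norm, $\sup_{\operatorname{Re}s>0}$ of the largest singular value of the transfer matrix, and when it is read as the norm induced by the $\mathcal L_2[0,\infty)$ norms of input and output signals for the system initially at rest, $\sup_{0\neq u\in \mathcal L_2}\|y-\hat y\|_2/\|u\|_2$.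 -/

import Mathlib

open MeasureTheory
open scoped Matrix ENNReal

/-- A continuous-time linear time-invariant system `ẋ = A x + B u`, `y = C x`, with state
coordinates indexed by `ι`, input coordinates by `μ` and output coordinates by `κ`. -/
structure LTISystem (ι μ κ : Type*) where
  A : Matrix ι ι ℝ
  B : Matrix ι μ ℝ
  C : Matrix κ ι ℝ

namespace LTISystem

/-- Asymptotic stability: every complex eigenvalue of `A` has negative real part. -/
def IsAsymptoticallyStable {ι μ κ : Type*} [Fintype ι] [DecidableEq ι]
    (G : LTISystem ι μ κ) : Prop :=
  ∀ s ∈ spectrum ℂ (G.A.map (algebraMap ℝ ℂ)), s.re < 0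

/-- The system in the new state coordinates `x̄ = W⁻¹ x`. -/
noncomputable def changeCoords {ι μ κ : Type*} [Fintype ι] [DecidableEq ι]
    (G : LTISystem ι μ κ) (W : Matrix ι ι ℝ) : LTISystem ι μ κ where
  A := W⁻¹ * G.A * W
  B := W⁻¹ * G.B
  C := G.C * W

/-- Truncation to the first `k` state coordinates: `(A₁₁, B₁, C₁)`. -/
def truncate {μ κ : Type*} {n : ℕ} (G : LTISystem (Fin n) μ κ) (k : ℕ) (hk : k ≤ n) :
    LTISystem (Fin k) μ κ where
  A := G.A.submatrix (Fin.castLE hk) (Fin.castLE hk)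
  B := G.B.submatrix (Fin.castLE hk) id
  C := G.C.submatrix id (Fin.castLE hk)

/-- The difference of two systems: both are driven by the same input, and the output is the
difference of the two outputs. -/
def sub {ι ι' μ κ : Type*} (G : LTISystem ι μ κ) (H : LTISystem ι' μ κ) :
    LTISystem (ι ⊕ ι') μ κ where
  A := Matrix.fromBlocks G.A 0 0 H.A
  B := Matrix.fromRows G.B H.B
  C := Matrix.fromCols G.C (-H.C)

/-- The transfer matrix `C (sI - A)⁻¹ B` (meaningful when `s` is not an eigenvalue of `A`). -/
noncomputable def transfer {ι μ κ : Type*} [Fintype ι] [DecidableEq ι]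
    (G : LTISystem ι μ κ) (s : ℂ) : Matrix κ μ ℂ :=
  G.C.map (algebraMap ℝ ℂ) * (s • (1 : Matrix ι ι ℂ) - G.A.map (algebraMap ℝ ℂ))⁻¹ *
    G.B.map (algebraMap ℝ ℂ)

/-- The `H∞` norm: the supremum over the open right half plane of the largest singular value
(Euclidean operator norm) of the transfer matrix. Eigenvalues of `A` are left out of the
supremum: a hidden mode is a removable singularity, so this does not change the supremum, and
near a genuine pole the transfer matrix is unbounded, so that the norm is then `∞`. -/
noncomputable def hInfNorm {ι μ κ : Type*} [Fintype ι] [DecidableEq ι] [Fintype μ]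
    [DecidableEq μ] [Fintype κ] (G : LTISystem ι μ κ) : ℝ≥0∞ :=
  ⨆ (s : ℂ) (_ : 0 < s.re) (_ : s ∉ spectrum ℂ (G.A.map (algebraMap ℝ ℂ))),
    ENNReal.ofReal ‖LinearMap.toContinuousLinearMap (Matrix.toEuclideanLin (G.transfer s))‖

/-- `x` is the (Carathéodory) state trajectory on `[0, ∞)` of the system started at rest,
`x(0) = 0`, and driven by the input `u`: the differential equation in integrated form. -/
def IsTrajectoryFromRest {ι μ κ : Type*} [Fintype ι] [Fintype μ]
    (G : LTISystem ι μ κ) (u : ℝ → EuclideanSpace ℝ μ) (x : ℝ → ι → ℝ) : Prop :=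
  ContinuousOn x (Set.Ici 0) ∧
    ∀ t : ℝ, 0 ≤ t → x t = ∫ τ in (0 : ℝ)..t, (G.A *ᵥ x τ + G.B *ᵥ (u τ).ofLp)

/-- The output signal `y = C x`. -/
noncomputable def output {ι μ κ : Type*} [Fintype ι]
    (G : LTISystem ι μ κ) (x : ℝ → ι → ℝ) (t : ℝ) : EuclideanSpace ℝ κ :=
  WithLp.toLp 2 (G.C *ᵥ x t)

end LTISystem

/-- The `L₂` norm `(∫₀^∞ |e(t)|² dt)^(1/2)` of a signal. -/
noncomputable def signalNorm {κ : Type*} [Fintype κ] (e : ℝ → EuclideanSpace ℝ κ) : ℝ≥0∞ :=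
  eLpNorm e 2 (volume.restrict (Set.Ici 0))

/-- The norm induced by the `L₂` norms on input and output signals, the system being
initially at rest. -/
noncomputable def LTISystem.inducedL2Norm {ι μ κ : Type*} [Fintype ι] [Fintype μ] [Fintype κ]
    (G : LTISystem ι μ κ) : ℝ≥0∞ :=
  ⨆ (u : ℝ → EuclideanSpace ℝ μ) (x : ℝ → ι → ℝ)
    (_ : MemLp u 2 (volume.restrict (Set.Ici 0))) (_ : signalNorm u ≠ 0)
    (_ : G.IsTrajectoryFromRest u x), signalNorm (G.output x) / signalNorm u

/-- The block matrix
`[[X, Q - A_oᵀ S], [Q - Sᵀ A_o, S + Sᵀ]]` with `X = -QA - AᵀQ - CᵀC` and `A_o = αI + A`. -/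
def extObsMatrix {ι μ κ : Type*} [Fintype ι] [DecidableEq ι] [Fintype κ]
    (G : LTISystem ι μ κ) (Q S : Matrix ι ι ℝ) (α : ℝ) : Matrix (ι ⊕ ι) (ι ⊕ ι) ℝ :=
  Matrix.fromBlocks
    (-(Q * G.A) - G.Aᵀ * Q - G.Cᵀ * G.C) (Q - (α • (1 : Matrix ι ι ℝ) + G.A)ᵀ * S)
    (Q - Sᵀ * (α • (1 : Matrix ι ι ℝ) + G.A)) (S + Sᵀ)

/-- The block matrix
`[[-PA - AᵀP, -P + A_cᵀ T, -2PB], [-P + Tᵀ A_c, T + Tᵀ, 2TᵀB], [-2BᵀP, 2BᵀT, 4I]]`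
with `A_c = βI + A`. -/
def extContrMatrix {ι μ κ : Type*} [Fintype ι] [DecidableEq ι] [Fintype μ] [DecidableEq μ]
    (G : LTISystem ι μ κ) (P T : Matrix ι ι ℝ) (β : ℝ) :
    Matrix ((ι ⊕ ι) ⊕ μ) ((ι ⊕ ι) ⊕ μ) ℝ :=
  Matrix.fromBlocks
    (Matrix.fromBlocks
      (-(P * G.A) - G.Aᵀ * P) (-P + (β • (1 : Matrix ι ι ℝ) + G.A)ᵀ * T)
      (-P + Tᵀ * (β • (1 : Matrix ι ι ℝ) + G.A)) (T + Tᵀ))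
    (Matrix.fromRows (-(2 : ℝ) • (P * G.B)) ((2 : ℝ) • (Tᵀ * G.B)))
    (Matrix.fromCols (-(2 : ℝ) • (G.Bᵀ * P)) ((2 : ℝ) • (G.Bᵀ * T)))
    ((4 : ℝ) • (1 : Matrix μ μ ℝ))

/-- `(Q, S, α)` is an extended observability Gramian of the system. -/
structure IsExtObsGramian {ι μ κ : Type*} [Fintype ι] [DecidableEq ι] [Fintype κ]
    (G : LTISystem ι μ κ) (Q S : Matrix ι ι ℝ) (α : ℝ) : Prop where
  posDef : Q.PosDef
  pos : 0 < α
  lmi : (extObsMatrix G Q S α).PosSemidef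

/-- `(P, T, β)` is an inverse extended controllability Gramian of the system. -/
structure IsInvExtContrGramian {ι μ κ : Type*} [Fintype ι] [DecidableEq ι] [Fintype μ]
    [DecidableEq μ] (G : LTISystem ι μ κ) (P T : Matrix ι ι ℝ) (β : ℝ) : Prop where
  posDef : P.PosDef
  nonneg : 0 ≤ β
  lmi : (extContrMatrix G P T β).PosSemidef

/-! States are deleted one at a time, the last one first. Each deletion costs at most `2 * σ
(Fin.last n)` in gain, the smaller system satisfies the same hypotheses, and the triangle inequality
sums the costs. No ordering of the `σ i` is needed.

Each matrix inequality is used only as an inequality in a state `x` and a free velocity `v`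
(`ObsDissipative`, `ContrDissipative`), which measures how far `v` is from obeying the dynamics. For
the full state `x` and the zero-padded reduced state `x'`, both driven by `u`, the observability
inequality is applied to the difference `x - x'` and the controllability inequality to the sum `x +
x'` with input `2u`. In both cases only the last equation is violated, by `w` and `-w` respectively.
The last coordinate of `α x + v` is the same number `z` for sum and difference, because the reduced
state and velocity vanish there and because `α = β`. The error terms are therefore `2 w σ z` and `-2
w σ⁻¹ z`; weighting the second inequality by `σ²` makes them cancel
(`truncation_error_dissipation`). Hence `(x - x')ᵀ Q (x - x') + σ² (x + x')ᵀ P (x + x')` is a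
storage function for the error system with supply `(2σ)² |u|² - |y - y'|²`.

A storage function bounds the gain both for exponential responses with `Re s > 0`
(`IsBoundedReal.freqGainLE`) and for square integrable signals (`IsBoundedReal.l2GainLE`). The
triangle inequality needs a response of the intermediate system, supplied by
`ObsDissipative.exists_isExpResponse` and `exists_isTrajectoryFromRest`. -/

set_option linter.unusedSectionVars false
set_option linter.unusedSimpArgs false

/-! ### Matrix inequalities as dissipation inequalities -/

section Algebra

variable {ι μ κ : Type*} [Fintype ι] [Fintype μ] [Fintype κ]

theorem dotProduct_transpose_mulVec_eq (M : Matrix κ ι ℝ) (x : ι → ℝ) (y : κ → ℝ) :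
    x ⬝ᵥ Mᵀ *ᵥ y = (M *ᵥ x) ⬝ᵥ y := by
  rw [Matrix.mulVec_transpose, dotProduct_comm, ← Matrix.dotProduct_mulVec, dotProduct_comm]

theorem dotProduct_weighted_comm (σ a b : ι → ℝ) : a ⬝ᵥ (σ * b) = b ⬝ᵥ (σ * a) := by
  simp only [dotProduct, Pi.mul_apply]
  exact Finset.sum_congr rfl fun i _ => by ring

theorem Matrix.IsSymm.dotProduct_mulVec_comm {Q : Matrix ι ι ℝ} (hQ : Q.IsSymm) (x y : ι → ℝ) :
    x ⬝ᵥ Q *ᵥ y = y ⬝ᵥ Q *ᵥ x := by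
  conv_lhs => rw [← hQ.eq]
  rw [dotProduct_transpose_mulVec_eq, dotProduct_comm]

theorem Matrix.IsHermitian.isSymm {Q : Matrix ι ι ℝ} (hQ : Q.IsHermitian) : Q.IsSymm := by
  have h := hQ.eq
  rwa [Matrix.conjTranspose_eq_transpose_of_trivial] at h

namespace LTISystem

/-- The dissipation inequality encoded by the extended observability Gramian `(Q, diag σ, α)`:
`v` plays the role of the derivative of a perturbed trajectory through `x`. -/
def ObsDissipative (G : LTISystem ι μ κ) (Q : Matrix ι ι ℝ) (σ : ι → ℝ) (α : ℝ) : Prop :=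
  ∀ x v : ι → ℝ, 2 * (x ⬝ᵥ Q *ᵥ v) + (G.C *ᵥ x) ⬝ᵥ (G.C *ᵥ x) ≤
    2 * ((v - G.A *ᵥ x) ⬝ᵥ (σ * (α • x + v)))

/-- The dissipation inequality encoded by the inverse extended controllability Gramian
`(P, diag τ, β)`. -/
def ContrDissipative (G : LTISystem ι μ κ) (P : Matrix ι ι ℝ) (τ : ι → ℝ) (β : ℝ) : Prop :=
  ∀ (x v : ι → ℝ) (u : μ → ℝ), 2 * (x ⬝ᵥ P *ᵥ v) ≤
    2 * ((v - G.A *ᵥ x - (2 : ℝ) • (G.B *ᵥ u)) ⬝ᵥ (τ * (β • x + v))) + 4 * (u ⬝ᵥ u)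

/-- `ξ ↦ ξᵀ K ξ` is a storage function with supply rate `γ² |u|² - |y|²`. -/
structure IsBoundedReal (H : LTISystem ι μ κ) (K : Matrix ι ι ℝ) (γ : ℝ) : Prop where
  posSemidef : K.PosSemidef
  dissipation : ∀ (ξ : ι → ℝ) (u : μ → ℝ),
    2 * (ξ ⬝ᵥ K *ᵥ (H.A *ᵥ ξ + H.B *ᵥ u)) + (H.C *ᵥ ξ) ⬝ᵥ (H.C *ᵥ ξ) ≤ γ ^ 2 * (u ⬝ᵥ u)

end LTISystem

open LTISystem

theorem IsExtObsGramian.obsDissipative [DecidableEq ι] {G : LTISystem ι μ κ} {Q : Matrix ι ι ℝ}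
    {σ : ι → ℝ} {α : ℝ} (h : IsExtObsGramian G Q (Matrix.diagonal σ) α) :
    G.ObsDissipative Q σ α := by
  intro x v
  have hs := h.posDef.isHermitian.isSymm
  have hD (y : ι → ℝ) : Matrix.diagonal σ *ᵥ y = σ * y := by
    ext i; simp [Matrix.mulVec_diagonal]
  -- With `p = A x - v` in the second slot, `Q A x - Q p` collapses to `Q v` and the terms in `p`
  -- combine to `-2 pᵀ diag(σ) (α x + v)`.
  have key := h.lmi.dotProduct_mulVec_nonneg (Sum.elim x (G.A *ᵥ x - v))
  simp only [extObsMatrix, star_trivial, Matrix.fromBlocks_mulVec, Sum.elim_comp_inl,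
    Sum.elim_comp_inr, sumElim_dotProduct_sumElim, ← Sum.elim_add_add, Matrix.sub_mulVec, Matrix.add_mulVec,
    Matrix.neg_mulVec, ← Matrix.mulVec_mulVec, dotProduct_add, dotProduct_sub, dotProduct_neg,
    dotProduct_transpose_mulVec_eq, Matrix.diagonal_transpose, hD, Matrix.smul_mulVec,
    Matrix.one_mulVec, Matrix.mulVec_sub, Matrix.mulVec_add, mul_add, mul_sub, sub_dotProduct,
    add_dotProduct, mul_smul_comm, dotProduct_smul, smul_dotProduct, smul_eq_mul,
    Matrix.transpose_add, Matrix.transpose_smul, Matrix.transpose_one] at key ⊢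
  have e1 := hs.dotProduct_mulVec_comm (G.A *ᵥ x) x
  have e2 := hs.dotProduct_mulVec_comm v x
  have e3 := dotProduct_weighted_comm σ (G.A *ᵥ x) x
  have e4 := dotProduct_weighted_comm σ v x
  have e5 := dotProduct_weighted_comm σ (G.A *ᵥ x) v
  simp only [e1, e2, e3, e4, e5] at key ⊢
  linarith

theorem IsInvExtContrGramian.contrDissipative [DecidableEq ι] [DecidableEq μ]
    {G : LTISystem ι μ κ} {P : Matrix ι ι ℝ}
    {τ : ι → ℝ} {β : ℝ} (h : IsInvExtContrGramian G P (Matrix.diagonal τ) β) :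
    G.ContrDissipative P τ β := by
  intro x v u
  have hs := h.posDef.isHermitian.isSymm
  have hD (y : ι → ℝ) : Matrix.diagonal τ *ᵥ y = τ * y := by
    ext i; simp [Matrix.mulVec_diagonal]
  -- The second slot is the residual `p` of the dynamics with input `2u`, so `A x + p + 2 B u = v`;
  -- this absorbs every term in `A` and `B` outside `p`.
  have key := h.lmi.dotProduct_mulVec_nonneg
    (Sum.elim (Sum.elim x (v - G.A *ᵥ x - (2 : ℝ) • (G.B *ᵥ u))) u)
  set a := G.A *ᵥ x with ha
  set b := G.B *ᵥ u with hb
  simp only [extContrMatrix, star_trivial, Matrix.fromBlocks_mulVec, Sum.elim_comp_inl,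
    Sum.elim_comp_inr, Matrix.fromRows_mulVec, Matrix.fromCols_mulVec,
    sumElim_dotProduct_sumElim, ← Sum.elim_add_add, Matrix.sub_mulVec, Matrix.add_mulVec,
    Matrix.neg_mulVec, ← Matrix.mulVec_mulVec, dotProduct_add, dotProduct_sub, dotProduct_neg,
    dotProduct_transpose_mulVec_eq, Matrix.diagonal_transpose, hD, Matrix.smul_mulVec,
    Matrix.one_mulVec, Matrix.mulVec_sub, Matrix.mulVec_add, Matrix.mulVec_smul,
    mul_add, mul_sub, sub_dotProduct,
    add_dotProduct, mul_smul_comm, dotProduct_smul, smul_dotProduct, smul_eq_mul,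
    Matrix.transpose_add, Matrix.transpose_smul, Matrix.transpose_one, ← ha, ← hb] at key ⊢
  have e1 := hs.dotProduct_mulVec_comm a x
  have e2 := hs.dotProduct_mulVec_comm v x
  have e0 := hs.dotProduct_mulVec_comm b x
  have e3 := dotProduct_weighted_comm τ a x
  have e4 := dotProduct_weighted_comm τ v x
  have e5 := dotProduct_weighted_comm τ a v
  have e6 := dotProduct_weighted_comm τ b x
  have e7 := dotProduct_weighted_comm τ b v
  have e8 := dotProduct_weighted_comm τ b a
  simp only [e0, e1, e2, e3, e4, e5, e6, e7, e8] at key ⊢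
  linarith

end Algebra

/-! ### Deleting one state -/

section Truncation

open LTISystem

variable {μ κ : Type*} {n : ℕ}

/-- Extension of a vector by a zero last coordinate. -/
def snocZero (x : Fin n → ℝ) : Fin (n + 1) → ℝ := Fin.snoc (α := fun _ => ℝ) x 0

@[simp] theorem snocZero_castSucc (x : Fin n → ℝ) (i : Fin n) : snocZero x i.castSucc = x i := by
  simp [snocZero]

@[simp] theorem snocZero_last (x : Fin n → ℝ) : snocZero x (Fin.last n) = 0 := by
  simp [snocZero]

theorem dotProduct_snocZero (y : Fin (n + 1) → ℝ) (x : Fin n → ℝ) :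
    y ⬝ᵥ snocZero x = (y ∘ Fin.castSucc) ⬝ᵥ x := by
  simp [dotProduct, Fin.sum_univ_castSucc]

theorem snocZero_dotProduct (y : Fin (n + 1) → ℝ) (x : Fin n → ℝ) :
    snocZero x ⬝ᵥ y = x ⬝ᵥ (y ∘ Fin.castSucc) := by
  simp [dotProduct, Fin.sum_univ_castSucc]

theorem mulVec_snocZero {ι : Type*} (M : Matrix ι (Fin (n + 1)) ℝ) (x : Fin n → ℝ) :
    M *ᵥ snocZero x = M.submatrix id Fin.castSucc *ᵥ x := by
  ext i
  simp [Matrix.mulVec, dotProduct_snocZero]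
  rfl

theorem truncate_A_mulVec (G : LTISystem (Fin (n + 1)) μ κ) (x : Fin n → ℝ) :
    (G.truncate n n.le_succ).A *ᵥ x = (G.A *ᵥ snocZero x) ∘ Fin.castSucc := by
  rw [mulVec_snocZero]; rfl

theorem truncate_B_mulVec [Fintype μ] (G : LTISystem (Fin (n + 1)) μ κ) (u : μ → ℝ) :
    (G.truncate n n.le_succ).B *ᵥ u = (G.B *ᵥ u) ∘ Fin.castSucc := rfl

theorem truncate_C_mulVec (G : LTISystem (Fin (n + 1)) μ κ) (x : Fin n → ℝ) :
    (G.truncate n n.le_succ).C *ᵥ x = G.C *ᵥ snocZero x := by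
  rw [mulVec_snocZero]; rfl

theorem submatrix_castSucc_mulVec (Q : Matrix (Fin (n + 1)) (Fin (n + 1)) ℝ) (x : Fin n → ℝ) :
    Q.submatrix Fin.castSucc Fin.castSucc *ᵥ x = (Q *ᵥ snocZero x) ∘ Fin.castSucc := by
  rw [mulVec_snocZero]; rfl

/-- For zero-padded `x` and `v` the last row of the residual `v - A x` need not vanish, but its
cofactor `σ * (α • x + v)` does. This relies on the weight being diagonal. -/
theorem LTISystem.ObsDissipative.truncate [Fintype κ] {G : LTISystem (Fin (n + 1)) μ κ}
    {Q : Matrix (Fin (n + 1)) (Fin (n + 1)) ℝ} {σ : Fin (n + 1) → ℝ} {α : ℝ}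
    (h : G.ObsDissipative Q σ α) :
    (G.truncate n n.le_succ).ObsDissipative (Q.submatrix Fin.castSucc Fin.castSucc)
      (σ ∘ Fin.castSucc) α := by
  intro x v
  have key := h (snocZero x) (snocZero v)
  rw [truncate_C_mulVec, submatrix_castSucc_mulVec, truncate_A_mulVec]
  rw [snocZero_dotProduct] at key
  convert key using 2
  simp [dotProduct, Fin.sum_univ_castSucc]

theorem LTISystem.ContrDissipative.truncate [Fintype μ] {G : LTISystem (Fin (n + 1)) μ κ}
    {P : Matrix (Fin (n + 1)) (Fin (n + 1)) ℝ} {τ : Fin (n + 1) → ℝ} {β : ℝ}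
    (h : G.ContrDissipative P τ β) :
    (G.truncate n n.le_succ).ContrDissipative (P.submatrix Fin.castSucc Fin.castSucc)
      (τ ∘ Fin.castSucc) β := by
  intro x v u
  have key := h (snocZero x) (snocZero v) u
  rw [submatrix_castSucc_mulVec, truncate_A_mulVec, truncate_B_mulVec]
  rw [snocZero_dotProduct] at key
  convert key using 3
  simp [dotProduct, Fin.sum_univ_castSucc]

/-- Dissipation inequality for the error made by deleting one state. -/
theorem truncation_error_dissipation [Fintype μ] [Fintype κ] {G : LTISystem (Fin (n + 1)) μ κ}
    {Q P : Matrix (Fin (n + 1)) (Fin (n + 1)) ℝ} {σ : Fin (n + 1) → ℝ} {α : ℝ}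
    (hσ : 0 < σ (Fin.last n))
    (hQ : G.ObsDissipative Q σ α) (hP : G.ContrDissipative P σ⁻¹ α)
    (x : Fin (n + 1) → ℝ) (x' : Fin n → ℝ) (u : μ → ℝ)
    (v : Fin (n + 1) → ℝ) (v' : Fin n → ℝ) (hv : v = G.A *ᵥ x + G.B *ᵥ u)
    (hv' : v' = (G.truncate n n.le_succ).A *ᵥ x' + (G.truncate n n.le_succ).B *ᵥ u) :
    2 * ((x - snocZero x') ⬝ᵥ Q *ᵥ (v - snocZero v')) +
      2 * (σ (Fin.last n) ^ 2 * ((x + snocZero x') ⬝ᵥ P *ᵥ (v + snocZero v'))) +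
      (G.C *ᵥ x - (G.truncate n n.le_succ).C *ᵥ x') ⬝ᵥ
        (G.C *ᵥ x - (G.truncate n n.le_succ).C *ᵥ x') ≤
      (2 * σ (Fin.last n)) ^ 2 * (u ⬝ᵥ u) := by
  have h1 := hQ (x - snocZero x') (v - snocZero v')
  have h2 := hP (x + snocZero x') (v + snocZero v') u
  rw [truncate_C_mulVec, ← Matrix.mulVec_sub]
  rw [truncate_A_mulVec, truncate_B_mulVec] at hv'
  -- The reduced system obeys all equations of the full one but the last, so both residuals live in
  -- the last coordinate.
  have w0 (i : Fin n) : (v - snocZero v' - G.A *ᵥ (x - snocZero x')) i.castSucc = 0 := by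
    simp [hv, hv', Matrix.mulVec_sub]
  have w1 (i : Fin n) : (v + snocZero v' - G.A *ᵥ (x + snocZero x') - (2 : ℝ) • G.B *ᵥ u)
      i.castSucc = 0 := by
    simp [hv, hv', Matrix.mulVec_add]; ring
  -- The last equation holds for `x`, so only the padded state contributes, with opposite signs in
  -- sum and difference.
  have w2 : (v + snocZero v' - G.A *ᵥ (x + snocZero x') - (2 : ℝ) • G.B *ᵥ u) (Fin.last n) =
      - (v - snocZero v' - G.A *ᵥ (x - snocZero x')) (Fin.last n) := by
    simp [hv, Matrix.mulVec_add, Matrix.mulVec_sub]; ring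
  have d1 : (v - snocZero v' - G.A *ᵥ (x - snocZero x')) ⬝ᵥ
      (σ * (α • (x - snocZero x') + (v - snocZero v'))) =
      (v - snocZero v' - G.A *ᵥ (x - snocZero x')) (Fin.last n) *
        (σ (Fin.last n) * (α * x (Fin.last n) + v (Fin.last n))) := by
    rw [dotProduct, Fin.sum_univ_castSucc]
    simp only [w0, zero_mul, Finset.sum_const_zero, zero_add]
    simp
  have d2 : (v + snocZero v' - G.A *ᵥ (x + snocZero x') - (2 : ℝ) • G.B *ᵥ u) ⬝ᵥ
      (σ⁻¹ * (α • (x + snocZero x') + (v + snocZero v'))) =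
      - (v - snocZero v' - G.A *ᵥ (x - snocZero x')) (Fin.last n) *
        ((σ (Fin.last n))⁻¹ * (α * x (Fin.last n) + v (Fin.last n))) := by
    rw [dotProduct, Fin.sum_univ_castSucc]
    simp only [w1, w2, zero_mul, Finset.sum_const_zero, zero_add]
    simp
  rw [d1] at h1
  rw [d2] at h2
  have h3 := mul_le_mul_of_nonneg_left h2 (sq_nonneg (σ (Fin.last n)))
  generalize (v - snocZero v' - G.A *ᵥ (x - snocZero x')) (Fin.last n) = w at *
  generalize α * x (Fin.last n) + v (Fin.last n) = z at *
  -- The weight `σ²` turns `σ⁻¹` into `σ`, so the `w`-term is exactly opposite to that of `h1`.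
  have e : σ (Fin.last n) ^ 2 * (2 * (-w * ((σ (Fin.last n))⁻¹ * z)) + 4 * u ⬝ᵥ u) =
      - (2 * (w * (σ (Fin.last n) * z))) + (2 * σ (Fin.last n)) ^ 2 * (u ⬝ᵥ u) := by
    field_simp
    ring
  rw [e] at h3
  linarith

theorem dotProduct_transpose_mul_mul_mulVec {ι ι' : Type*} [Fintype ι] [Fintype ι'] (L : Matrix ι ι' ℝ)
    (Q : Matrix ι ι ℝ) (ξ η : ι' → ℝ) :
    ξ ⬝ᵥ (Lᵀ * Q * L) *ᵥ η = (L *ᵥ ξ) ⬝ᵥ Q *ᵥ (L *ᵥ η) := by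
  rw [← Matrix.mulVec_mulVec, ← Matrix.mulVec_mulVec, dotProduct_transpose_mulVec_eq]

theorem Matrix.PosSemidef.transpose_mul_mul_same {ι ι' : Type*} [Fintype ι] [Fintype ι']
    {Q : Matrix ι ι ℝ} (hQ : Q.PosSemidef) (L : Matrix ι ι' ℝ) : (Lᵀ * Q * L).PosSemidef := by
  have := hQ.conjTranspose_mul_mul_same L
  rwa [Matrix.conjTranspose_eq_transpose_of_trivial] at this

theorem LTISystem.sub_vectorField {ι ι' μ κ : Type*} [Fintype ι] [Fintype ι'] [Fintype μ]
    (G : LTISystem ι μ κ) (H : LTISystem ι' μ κ) (x : ι → ℝ) (x' : ι' → ℝ) (u : μ → ℝ) :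
    (G.sub H).A *ᵥ (Sum.elim x x') + (G.sub H).B *ᵥ u =
      Sum.elim (G.A *ᵥ x + G.B *ᵥ u) (H.A *ᵥ x' + H.B *ᵥ u) := by
  simp [LTISystem.sub, Matrix.fromBlocks_mulVec, Matrix.fromRows_mulVec, Sum.elim_add_add]

theorem LTISystem.sub_C_mulVec {ι ι' μ κ : Type*} [Fintype ι] [Fintype ι']
    (G : LTISystem ι μ κ) (H : LTISystem ι' μ κ) (x : ι → ℝ) (x' : ι' → ℝ) :
    (G.sub H).C *ᵥ (Sum.elim x x') = G.C *ᵥ x - H.C *ᵥ x' := by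
  simp [LTISystem.sub, Matrix.fromCols_mulVec, Matrix.neg_mulVec, sub_eq_add_neg]

theorem isBoundedReal_sub_truncate [Fintype μ] [Fintype κ] {G : LTISystem (Fin (n + 1)) μ κ}
    {Q P : Matrix (Fin (n + 1)) (Fin (n + 1)) ℝ} {σ : Fin (n + 1) → ℝ} {α : ℝ}
    (hσ : 0 < σ (Fin.last n)) (hQ₀ : Q.PosSemidef) (hP₀ : P.PosSemidef)
    (hQ : G.ObsDissipative Q σ α) (hP : G.ContrDissipative P σ⁻¹ α) :
    ∃ K, (G.sub (G.truncate n n.le_succ)).IsBoundedReal K (2 * σ (Fin.last n)) := by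
  let E : Matrix (Fin (n + 1)) (Fin n) ℝ :=
    (1 : Matrix (Fin (n + 1)) (Fin (n + 1)) ℝ).submatrix id Fin.castSucc
  have hE (x : Fin n → ℝ) : E *ᵥ x = snocZero x := by
    rw [← mulVec_snocZero, Matrix.one_mulVec]
  let L₁ : Matrix (Fin (n + 1)) (Fin (n + 1) ⊕ Fin n) ℝ := Matrix.fromCols 1 (-E)
  let L₂ : Matrix (Fin (n + 1)) (Fin (n + 1) ⊕ Fin n) ℝ := Matrix.fromCols 1 E
  refine ⟨L₁ᵀ * Q * L₁ + σ (Fin.last n) ^ 2 • (L₂ᵀ * P * L₂),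
    (hQ₀.transpose_mul_mul_same L₁).add ((hP₀.transpose_mul_mul_same L₂).smul (sq_nonneg _)),
    fun ξ u => ?_⟩
  obtain ⟨x, x', rfl⟩ : ∃ x x', ξ = Sum.elim x x' := ⟨ξ ∘ Sum.inl, ξ ∘ Sum.inr, by simp⟩
  have key := truncation_error_dissipation hσ hQ hP x x' u _ _ rfl rfl
  simp only [Matrix.add_mulVec, Matrix.smul_mulVec, dotProduct_add, dotProduct_smul,
    dotProduct_transpose_mul_mul_mulVec, smul_eq_mul]
  have h1 (a : Fin (n + 1) → ℝ) (b : Fin n → ℝ) : L₁ *ᵥ (Sum.elim a b) = a - snocZero b := by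
    simp [L₁, Matrix.fromCols_mulVec, Matrix.neg_mulVec, hE, sub_eq_add_neg]
  have h2 (a : Fin (n + 1) → ℝ) (b : Fin n → ℝ) : L₂ *ᵥ (Sum.elim a b) = a + snocZero b := by
    simp [L₂, Matrix.fromCols_mulVec, hE]
  rw [LTISystem.sub_vectorField, LTISystem.sub_C_mulVec, h1, h2, h1, h2, mul_add]
  exact key

/-- The input cancels in `x - x'`, for which `Q` is a Lyapunov matrix. This is the case in which no
state is deleted. -/
theorem isBoundedReal_sub_self [Fintype μ] [Fintype κ] {ι : Type*} [Fintype ι] [DecidableEq ι]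
    {G : LTISystem ι μ κ}
    {Q : Matrix ι ι ℝ} {σ : ι → ℝ} {α : ℝ} (hQ₀ : Q.PosSemidef) (hQ : G.ObsDissipative Q σ α) :
    ∃ K, (G.sub G).IsBoundedReal K 0 := by
  let L : Matrix ι (ι ⊕ ι) ℝ := Matrix.fromCols 1 (-1)
  refine ⟨Lᵀ * Q * L, hQ₀.transpose_mul_mul_same L, fun ξ u => ?_⟩
  obtain ⟨x, x', rfl⟩ : ∃ x x', ξ = Sum.elim x x' := ⟨ξ ∘ Sum.inl, ξ ∘ Sum.inr, by simp⟩
  have key := hQ (x - x') (G.A *ᵥ (x - x'))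
  have h1 (a b : ι → ℝ) : L *ᵥ (Sum.elim a b) = a - b := by
    simp [L, Matrix.fromCols_mulVec, Matrix.neg_mulVec, sub_eq_add_neg]
  rw [dotProduct_transpose_mul_mul_mulVec, LTISystem.sub_vectorField, LTISystem.sub_C_mulVec, h1, h1,
    add_sub_add_right_eq_sub, ← Matrix.mulVec_sub, ← Matrix.mulVec_sub]
  simpa using key

end Truncation

/-! ### Gain of exponential responses and the `H∞` norm -/

section Frequency

variable {ι ι' ι'' μ κ : Type*} [Fintype ι] [Fintype ι'] [Fintype ι''] [Fintype μ] [Fintype κ]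

theorem re_map_mulVec (M : Matrix κ ι ℝ) (ξ : ι → ℂ) :
    Complex.re ∘ (M.map (algebraMap ℝ ℂ) *ᵥ ξ) = M *ᵥ (Complex.re ∘ ξ) := by
  ext i; simp [Matrix.mulVec, dotProduct]

theorem im_map_mulVec (M : Matrix κ ι ℝ) (ξ : ι → ℂ) :
    Complex.im ∘ (M.map (algebraMap ℝ ℂ) *ᵥ ξ) = M *ᵥ (Complex.im ∘ ξ) := by
  ext i; simp [Matrix.mulVec, dotProduct]

theorem norm_toLp_sq_complex (y : κ → ℂ) :
    ‖WithLp.toLp 2 y‖ ^ 2 = (Complex.re ∘ y) ⬝ᵥ (Complex.re ∘ y) +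
      (Complex.im ∘ y) ⬝ᵥ (Complex.im ∘ y) := by
  rw [EuclideanSpace.norm_sq_eq, dotProduct, dotProduct, ← Finset.sum_add_distrib]
  refine Finset.sum_congr rfl fun i _ => ?_
  rw [Complex.sq_norm, Complex.normSq_apply]
  rfl

namespace LTISystem

/-- `ξ` is the complex amplitude of an exponential state response `e^{st} ξ` to the input
`e^{st} u`. -/
def IsExpResponse (H : LTISystem ι μ κ) (s : ℂ) (u : μ → ℂ) (ξ : ι → ℂ) : Prop :=
  s • ξ = H.A.map (algebraMap ℝ ℂ) *ᵥ ξ + H.B.map (algebraMap ℝ ℂ) *ᵥ u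

/-- The gain of exponential responses is at most `γ` in the open right half plane. -/
def FreqGainLE (H : LTISystem ι μ κ) (γ : ℝ) : Prop :=
  ∀ (s : ℂ) (u : μ → ℂ) (ξ : ι → ℂ), 0 < s.re → H.IsExpResponse s u ξ →
    ‖WithLp.toLp 2 (H.C.map (algebraMap ℝ ℂ) *ᵥ ξ)‖ ≤ γ * ‖WithLp.toLp 2 u‖

theorem IsExpResponse.re {H : LTISystem ι μ κ} {s : ℂ} {u : μ → ℂ} {ξ : ι → ℂ}
    (h : H.IsExpResponse s u ξ) :
    H.A *ᵥ (Complex.re ∘ ξ) + H.B *ᵥ (Complex.re ∘ u) =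
      s.re • (Complex.re ∘ ξ) - s.im • (Complex.im ∘ ξ) := by
  rw [← re_map_mulVec, ← re_map_mulVec]
  ext i
  have := congrArg Complex.re (congrFun h i)
  simpa using this.symm

theorem IsExpResponse.im {H : LTISystem ι μ κ} {s : ℂ} {u : μ → ℂ} {ξ : ι → ℂ}
    (h : H.IsExpResponse s u ξ) :
    H.A *ᵥ (Complex.im ∘ ξ) + H.B *ᵥ (Complex.im ∘ u) =
      s.re • (Complex.im ∘ ξ) + s.im • (Complex.re ∘ ξ) := by
  rw [← im_map_mulVec, ← im_map_mulVec]
  ext i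
  have := congrArg Complex.im (congrFun h i)
  simpa using this.symm

/-- The dissipation inequality is added for real and imaginary parts. The `Im s` terms cancel by
symmetry of `K`, and the storage terms leave `2 Re s` times a nonnegative form. -/
theorem IsBoundedReal.freqGainLE {H : LTISystem ι μ κ} {K : Matrix ι ι ℝ} {γ : ℝ}
    (h : H.IsBoundedReal K γ) (hγ : 0 ≤ γ) : H.FreqGainLE γ := by
  intro s u ξ hs hξ
  refine le_of_sq_le_sq ?_ (by positivity)
  rw [mul_pow, norm_toLp_sq_complex, norm_toLp_sq_complex, re_map_mulVec, im_map_mulVec]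
  have h1 := h.dissipation (Complex.re ∘ ξ) (Complex.re ∘ u)
  have h2 := h.dissipation (Complex.im ∘ ξ) (Complex.im ∘ u)
  have p1 := h.posSemidef.dotProduct_mulVec_nonneg (Complex.re ∘ ξ)
  have p2 := h.posSemidef.dotProduct_mulVec_nonneg (Complex.im ∘ ξ)
  have hsym := h.posSemidef.isHermitian.isSymm.dotProduct_mulVec_comm
    (Complex.re ∘ ξ) (Complex.im ∘ ξ)
  rw [hξ.re] at h1
  rw [hξ.im] at h2
  simp only [Matrix.mulVec_add, Matrix.mulVec_sub, Matrix.mulVec_smul, dotProduct_add,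
    dotProduct_sub, dotProduct_smul, smul_eq_mul, star_trivial] at h1 h2 p1 p2
  have q1 := mul_nonneg hs.le p1
  have q2 := mul_nonneg hs.le p2
  rw [hsym] at h1
  linarith

/-- Taking `v = A x` kills the right-hand side and leaves the Lyapunov inequality for `Q`, which
excludes eigenvalues with positive real part. Truncations inherit this. -/
theorem ObsDissipative.eq_zero_of_smul_eq {G : LTISystem ι μ κ} {Q : Matrix ι ι ℝ} {σ : ι → ℝ}
    {α : ℝ} (hQ : G.ObsDissipative Q σ α) (hQ₀ : Q.PosDef) {s : ℂ} (hs : 0 < s.re) {ξ : ι → ℂ}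
    (hξ : s • ξ = G.A.map (algebraMap ℝ ℂ) *ᵥ ξ) : ξ = 0 := by
  have hr : G.IsExpResponse s 0 ξ := by simp [IsExpResponse, hξ]
  have e1 := hr.re
  have e2 := hr.im
  have hz1 : (Complex.re ∘ (0 : μ → ℂ)) = 0 := by ext; simp
  have hz2 : (Complex.im ∘ (0 : μ → ℂ)) = 0 := by ext; simp
  rw [hz1, Matrix.mulVec_zero, add_zero] at e1
  rw [hz2, Matrix.mulVec_zero, add_zero] at e2
  have h1 := hQ (Complex.re ∘ ξ) (G.A *ᵥ (Complex.re ∘ ξ))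
  have h2 := hQ (Complex.im ∘ ξ) (G.A *ᵥ (Complex.im ∘ ξ))
  rw [sub_self, zero_dotProduct, mul_zero, e1] at h1
  rw [sub_self, zero_dotProduct, mul_zero, e2] at h2
  have c1 : 0 ≤ (G.C *ᵥ (Complex.re ∘ ξ)) ⬝ᵥ (G.C *ᵥ (Complex.re ∘ ξ)) :=
    dotProduct_self_star_nonneg (R := ℝ) _
  have c2 : 0 ≤ (G.C *ᵥ (Complex.im ∘ ξ)) ⬝ᵥ (G.C *ᵥ (Complex.im ∘ ξ)) :=
    dotProduct_self_star_nonneg (R := ℝ) _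
  have hsym := hQ₀.isHermitian.isSymm.dotProduct_mulVec_comm (Complex.re ∘ ξ) (Complex.im ∘ ξ)
  have p1 := hQ₀.posSemidef.dotProduct_mulVec_nonneg (Complex.re ∘ ξ)
  have p2 := hQ₀.posSemidef.dotProduct_mulVec_nonneg (Complex.im ∘ ξ)
  simp only [Matrix.mulVec_add, Matrix.mulVec_sub, Matrix.mulVec_smul, dotProduct_add,
    dotProduct_sub, dotProduct_smul, smul_eq_mul, star_trivial] at h1 h2 p1 p2
  rw [hsym] at h1
  have q1 := mul_nonneg hs.le p1
  have q2 := mul_nonneg hs.le p2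
  have z1 : Complex.re ∘ ξ = 0 := by
    by_contra hne
    have := mul_pos hs (hQ₀.dotProduct_mulVec_pos hne)
    simp only [star_trivial] at this
    linarith
  have z2 : Complex.im ∘ ξ = 0 := by
    by_contra hne
    have := mul_pos hs (hQ₀.dotProduct_mulVec_pos hne)
    simp only [star_trivial] at this
    linarith
  ext i
  exact Complex.ext (congrFun z1 i) (congrFun z2 i)

theorem ObsDissipative.exists_isExpResponse {G : LTISystem ι μ κ} {Q : Matrix ι ι ℝ} {σ : ι → ℝ}
    {α : ℝ} (hQ : G.ObsDissipative Q σ α) (hQ₀ : Q.PosDef) {s : ℂ} (hs : 0 < s.re) (u : μ → ℂ) :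
    ∃ ξ, G.IsExpResponse s u ξ := by
  classical
  let f : (ι → ℂ) →ₗ[ℂ] (ι → ℂ) :=
    s • LinearMap.id - (G.A.map (algebraMap ℝ ℂ)).mulVecLin
  have hf (ξ : ι → ℂ) : f ξ = s • ξ - G.A.map (algebraMap ℝ ℂ) *ᵥ ξ := rfl
  have hinj : Function.Injective f := by
    rw [← LinearMap.ker_eq_bot, LinearMap.ker_eq_bot']
    intro ξ h
    rw [hf, sub_eq_zero] at h
    exact hQ.eq_zero_of_smul_eq hQ₀ hs h
  obtain ⟨ξ, hξ⟩ := LinearMap.surjective_of_injective hinj (G.B.map (algebraMap ℝ ℂ) *ᵥ u)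
  refine ⟨ξ, ?_⟩
  rw [hf, sub_eq_iff_eq_add'] at hξ
  exact hξ

theorem isExpResponse_sub_iff (G : LTISystem ι μ κ) (H : LTISystem ι' μ κ) (s : ℂ) (u : μ → ℂ)
    (x : ι → ℂ) (x' : ι' → ℂ) :
    (G.sub H).IsExpResponse s u (Sum.elim x x') ↔
      G.IsExpResponse s u x ∧ H.IsExpResponse s u x' := by
  have h1 : (G.sub H).B.map (algebraMap ℝ ℂ) *ᵥ u =
      Sum.elim (G.B.map (algebraMap ℝ ℂ) *ᵥ u) (H.B.map (algebraMap ℝ ℂ) *ᵥ u) := by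
    ext i; cases i <;> rfl
  have h2 : s • Sum.elim x x' = Sum.elim (s • x) (s • x') := by
    ext i; cases i <;> rfl
  unfold IsExpResponse
  rw [h1, h2]
  simp only [sub, Matrix.fromBlocks_map, Matrix.map_zero _ (map_zero (algebraMap ℝ ℂ)),
    Matrix.fromBlocks_mulVec, Sum.elim_comp_inl, Sum.elim_comp_inr, Matrix.zero_mulVec, add_zero,
    zero_add, ← Sum.elim_add_add, Sum.elim_eq_iff]

theorem sub_C_map_mulVec (G : LTISystem ι μ κ) (H : LTISystem ι' μ κ)
    (x : ι → ℂ) (x' : ι' → ℂ) :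
    (G.sub H).C.map (algebraMap ℝ ℂ) *ᵥ (Sum.elim x x') =
      G.C.map (algebraMap ℝ ℂ) *ᵥ x - H.C.map (algebraMap ℝ ℂ) *ᵥ x' := by
  ext i
  simp [sub, Matrix.mulVec, dotProduct, sub_eq_add_neg]

theorem FreqGainLE.sub_trans {G : LTISystem ι μ κ} {H : LTISystem ι' μ κ} {K : LTISystem ι'' μ κ}
    {γ δ : ℝ} (hGH : (G.sub H).FreqGainLE γ) (hHK : (H.sub K).FreqGainLE δ)
    (hH : ∀ (s : ℂ) (u : μ → ℂ), 0 < s.re → ∃ x, H.IsExpResponse s u x) :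
    (G.sub K).FreqGainLE (γ + δ) := by
  intro s u ξ hs hξ
  obtain ⟨x, z, rfl⟩ : ∃ x z, ξ = Sum.elim x z := ⟨ξ ∘ Sum.inl, ξ ∘ Sum.inr, by simp⟩
  rw [isExpResponse_sub_iff] at hξ
  obtain ⟨y, hy⟩ := hH s u hs
  have h1 := hGH s u _ hs ((isExpResponse_sub_iff G H s u x y).2 ⟨hξ.1, hy⟩)
  have h2 := hHK s u _ hs ((isExpResponse_sub_iff H K s u y z).2 ⟨hy, hξ.2⟩)
  rw [sub_C_map_mulVec] at h1 h2 ⊢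
  rw [← sub_add_sub_cancel _ (H.C.map (algebraMap ℝ ℂ) *ᵥ y), WithLp.toLp_add, add_mul]
  exact (norm_add_le _ _).trans (add_le_add h1 h2)

theorem FreqGainLE.of_changeCoords [DecidableEq ι] {G : LTISystem ι μ κ} {H : LTISystem ι' μ κ}
    {W : Matrix ι ι ℝ} (hW : IsUnit W) {γ : ℝ}
    (h : ((G.changeCoords W).sub H).FreqGainLE γ) : (G.sub H).FreqGainLE γ := by
  intro s u ξ hs hξ
  obtain ⟨x, z, rfl⟩ : ∃ x z, ξ = Sum.elim x z := ⟨ξ ∘ Sum.inl, ξ ∘ Sum.inr, by simp⟩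
  rw [isExpResponse_sub_iff] at hξ
  have hWW : W * W⁻¹ = 1 := Matrix.mul_nonsing_inv W ((Matrix.isUnit_iff_isUnit_det W).1 hW)
  have hWW' : W.map (algebraMap ℝ ℂ) * W⁻¹.map (algebraMap ℝ ℂ) = 1 := by
    rw [← Matrix.map_mul, hWW, Matrix.map_one _ (map_zero _) (map_one _)]
  have hx : W.map (algebraMap ℝ ℂ) *ᵥ (W⁻¹.map (algebraMap ℝ ℂ) *ᵥ x) = x := by
    rw [Matrix.mulVec_mulVec, hWW', Matrix.one_mulVec]
  have h1 : (G.changeCoords W).IsExpResponse s u (W⁻¹.map (algebraMap ℝ ℂ) *ᵥ x) := by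
    have := congrArg (W⁻¹.map (algebraMap ℝ ℂ) *ᵥ ·) hξ.1
    simp only [Matrix.mulVec_smul, Matrix.mulVec_add] at this
    simp only [IsExpResponse, changeCoords, Matrix.map_mul, ← Matrix.mulVec_mulVec, hx]
    exact this
  have h2 := h s u _ hs ((isExpResponse_sub_iff _ H s u _ z).2 ⟨h1, hξ.2⟩)
  rw [sub_C_map_mulVec] at h2 ⊢
  simpa only [changeCoords, Matrix.map_mul, ← Matrix.mulVec_mulVec, hx] using h2

theorem FreqGainLE.hInfNorm_le [DecidableEq ι] [DecidableEq μ] {H : LTISystem ι μ κ} {γ : ℝ}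
    (h : H.FreqGainLE γ) (hγ : 0 ≤ γ) : H.hInfNorm ≤ ENNReal.ofReal γ := by
  refine iSup_le fun s => iSup_le fun hs => iSup_le fun hspec => ENNReal.ofReal_le_ofReal ?_
  refine ContinuousLinearMap.opNorm_le_bound _ hγ fun u => ?_
  rw [spectrum.notMem_iff, Algebra.algebraMap_eq_smul_one] at hspec
  have hinv := Matrix.mul_nonsing_inv _ ((Matrix.isUnit_iff_isUnit_det _).1 hspec)
  set R := (s • (1 : Matrix ι ι ℂ) - H.A.map (algebraMap ℝ ℂ))⁻¹ with hR
  have key := h s u.ofLp (R *ᵥ (H.B.map (algebraMap ℝ ℂ) *ᵥ u.ofLp)) hs (by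
    have := congrArg (· *ᵥ (H.B.map (algebraMap ℝ ℂ) *ᵥ u.ofLp)) hinv
    simp only [← Matrix.mulVec_mulVec, Matrix.sub_mulVec, Matrix.smul_mulVec,
      Matrix.one_mulVec] at this
    rw [sub_eq_iff_eq_add'] at this
    exact this)
  simp only [Matrix.mulVec_mulVec, ← Matrix.mul_assoc] at key
  exact key

end LTISystem

end Frequency

/-! ### Energy balance and the `L₂` gain -/

section TimeDomain

variable {ι ι' ι'' μ κ : Type*} [Fintype ι] [Fintype ι'] [Fintype ι''] [Fintype μ] [Fintype κ]

/-- Product rule for indefinite integrals. -/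
theorem integral_mul_integral_eq {f g : ℝ → ℝ} {T : ℝ} (hf : IntervalIntegrable f volume 0 T)
    (hg : IntervalIntegrable g volume 0 T) :
    (∫ t in 0..T, f t) * (∫ t in 0..T, g t) =
      ∫ t in 0..T, (f t * (∫ τ in 0..t, g τ) + (∫ τ in 0..t, f τ) * g t) := by
  -- The factors are merely integrable, so the integrals are differentiable only almost everywhere;
  -- absolute continuity still permits integration by parts.
  have aF := hf.absolutelyContinuousOnInterval_intervalIntegral (c := 0) (by simp)
  have aG := hg.absolutelyContinuousOnInterval_intervalIntegral (c := 0) (by simp)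
  have h := aF.integral_deriv_mul_eq_sub aG
  simp only [intervalIntegral.integral_same, mul_zero, sub_zero] at h
  rw [← h]
  refine intervalIntegral.integral_congr_ae ?_
  filter_upwards [hf.ae_hasDerivAt_integral, hg.ae_hasDerivAt_integral] with t h1 h2 ht
  rw [(h1 (Set.uIoc_subset_uIcc ht) 0 (by simp)).deriv,
    (h2 (Set.uIoc_subset_uIcc ht) 0 (by simp)).deriv]

theorem IntervalIntegrable.finsetSum {f : ι → ℝ → ℝ} {a b : ℝ}
    (hf : ∀ i, IntervalIntegrable (f i) volume a b) :
    IntervalIntegrable (fun t => ∑ i, f i t) volume a b := by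
  simpa only [Finset.sum_fn] using IntervalIntegrable.sum Finset.univ fun i _ => hf i

theorem continuousOn_integral {f : ℝ → ℝ} {T : ℝ} (hf : IntervalIntegrable f volume 0 T) :
    ContinuousOn (fun t => ∫ τ in 0..t, f τ) (Set.uIcc 0 T) :=
  (hf.absolutelyContinuousOnInterval_intervalIntegral (c := 0) (by simp)).continuousOn

theorem MeasureTheory.MemLp.restrict_Icc {u : ℝ → EuclideanSpace ℝ μ}
    (hu : MemLp u 2 (volume.restrict (Set.Ici 0))) (T : ℝ) :
    MemLp u 2 (volume.restrict (Set.Icc 0 T)) :=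
  hu.mono_measure (Measure.restrict_mono Set.Icc_subset_Ici_self le_rfl)

theorem MeasureTheory.MemLp.intervalIntegrable_apply {u : ℝ → EuclideanSpace ℝ μ}
    (hu : MemLp u 2 (volume.restrict (Set.Ici 0))) {T : ℝ} (hT : 0 ≤ T) (j : μ) :
    IntervalIntegrable (fun t => u t j) volume 0 T := by
  rw [intervalIntegrable_iff_integrableOn_Icc_of_le hT]
  have h := (hu.restrict_Icc T).integrable (by norm_num)
  exact (EuclideanSpace.proj (𝕜 := ℝ) j).integrable_comp h

theorem MeasureTheory.MemLp.integrableOn_norm_sq {u : ℝ → EuclideanSpace ℝ μ}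
    (hu : MemLp u 2 (volume.restrict (Set.Ici 0))) (T : ℝ) :
    IntegrableOn (fun t => ‖u t‖ ^ 2) (Set.Icc 0 T) :=
  (hu.restrict_Icc T).integrable_norm_pow (by norm_num)

theorem norm_toLp_sq_real (y : κ → ℝ) : ‖WithLp.toLp 2 y‖ ^ 2 = y ⬝ᵥ y := by
  rw [EuclideanSpace.norm_sq_eq, dotProduct]
  exact Finset.sum_congr rfl fun i _ => by simp [sq]

namespace LTISystem

theorem IsTrajectoryFromRest.continuousOn_apply {H : LTISystem ι μ κ} {u : ℝ → EuclideanSpace ℝ μ}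
    {x : ℝ → ι → ℝ} (hx : H.IsTrajectoryFromRest u x) (i : ι) :
    ContinuousOn (fun t => x t i) (Set.Ici 0) :=
  (continuous_apply i).comp_continuousOn hx.1

theorem IsTrajectoryFromRest.intervalIntegrable {H : LTISystem ι μ κ}
    {u : ℝ → EuclideanSpace ℝ μ} {x : ℝ → ι → ℝ} (hx : H.IsTrajectoryFromRest u x)
    (hu : MemLp u 2 (volume.restrict (Set.Ici 0))) {T : ℝ} (hT : 0 ≤ T) (i : ι) :
    IntervalIntegrable (fun τ => (H.A *ᵥ x τ + H.B *ᵥ (u τ).ofLp) i) volume 0 T := by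
  simp only [Pi.add_apply, Matrix.mulVec, dotProduct]
  refine IntervalIntegrable.add ?_ ?_
  · refine ContinuousOn.intervalIntegrable ?_
    rw [Set.uIcc_of_le hT]
    exact continuousOn_finsetSum _ fun j _ => continuousOn_const.mul
      ((hx.continuousOn_apply j).mono Set.Icc_subset_Ici_self)
  · exact IntervalIntegrable.finsetSum fun j => (hu.intervalIntegrable_apply hT j).const_mul _

theorem intervalIntegral_apply {f : ℝ → ι → ℝ} {T : ℝ} (hT : 0 ≤ T)
    (hf : ∀ i, IntervalIntegrable (fun t => f t i) volume 0 T) (i : ι) :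
    (∫ t in 0..T, f t) i = ∫ t in 0..T, f t i := by
  rw [intervalIntegral.integral_of_le hT, intervalIntegral.integral_of_le hT]
  exact eval_integral (fun j => (intervalIntegrable_iff_integrableOn_Ioc_of_le hT).1 (hf j)) i

theorem IsTrajectoryFromRest.apply_eq {H : LTISystem ι μ κ}
    {u : ℝ → EuclideanSpace ℝ μ} {x : ℝ → ι → ℝ} (hx : H.IsTrajectoryFromRest u x)
    (hu : MemLp u 2 (volume.restrict (Set.Ici 0))) {T : ℝ} (hT : 0 ≤ T) (i : ι) :
    x T i = ∫ τ in 0..T, (H.A *ᵥ x τ + H.B *ᵥ (u τ).ofLp) i := by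
  conv_lhs => rw [hx.2 T hT]
  exact intervalIntegral_apply hT (fun j => hx.intervalIntegrable hu hT j) i

/-- Energy balance of a quadratic storage function along a trajectory. -/
theorem IsTrajectoryFromRest.storage_eq {H : LTISystem ι μ κ}
    {u : ℝ → EuclideanSpace ℝ μ} {x : ℝ → ι → ℝ} (hx : H.IsTrajectoryFromRest u x)
    (hu : MemLp u 2 (volume.restrict (Set.Ici 0))) {K : Matrix ι ι ℝ} (hK : K.IsSymm)
    {T : ℝ} (hT : 0 ≤ T) :
    IntervalIntegrable (fun t => 2 * (x t ⬝ᵥ K *ᵥ (H.A *ᵥ x t + H.B *ᵥ (u t).ofLp))) volume 0 T ∧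
    x T ⬝ᵥ K *ᵥ x T =
      ∫ t in 0..T, 2 * (x t ⬝ᵥ K *ᵥ (H.A *ᵥ x t + H.B *ᵥ (u t).ofLp)) := by
  set f : ℝ → ι → ℝ := fun t => H.A *ᵥ x t + H.B *ᵥ (u t).ofLp with hf
  have hfi (i : ι) : IntervalIntegrable (fun t => f t i) volume 0 T := hx.intervalIntegrable hu hT i
  have hc (i : ι) : ContinuousOn (fun t => x t i) (Set.uIcc 0 T) := by
    rw [Set.uIcc_of_le hT]
    exact (hx.continuousOn_apply i).mono Set.Icc_subset_Ici_self
  have hp (i j : ι) : IntervalIntegrable (fun t => f t i * x t j + x t i * f t j) volume 0 T :=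
    ((hfi i).mul_continuousOn (hc j)).add ((hfi j).continuousOn_mul (hc i))
  have hpe (i j : ι) : x T i * x T j = ∫ t in 0..T, (f t i * x t j + x t i * f t j) := by
    rw [hx.apply_eq hu hT i, hx.apply_eq hu hT j, integral_mul_integral_eq (hfi i) (hfi j)]
    refine intervalIntegral.integral_congr fun t ht => ?_
    rw [Set.uIcc_of_le hT] at ht
    simp only [hx.apply_eq hu ht.1 i, hx.apply_eq hu ht.1 j, hf]
  obtain ⟨k, hk⟩ : ∃ k : ι → ι → ℝ, ∀ i j, K i j = k i j := ⟨K, fun _ _ => rfl⟩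
  -- Symmetry of `K` splits the factor `2` into the two halves of the product rule for each `x i * x
  -- j`.
  have hsum (t : ℝ) : 2 * (x t ⬝ᵥ K *ᵥ f t) =
      ∑ i, ∑ j, k i j * (f t i * x t j + x t i * f t j) := by
    have h1 : x t ⬝ᵥ K *ᵥ f t = ∑ i, ∑ j, k i j * (x t i * f t j) := by
      simp only [dotProduct, Matrix.mulVec, Finset.mul_sum, hk]
      exact Finset.sum_congr rfl fun i _ => Finset.sum_congr rfl fun j _ => by ring
    have h2 : f t ⬝ᵥ K *ᵥ x t = ∑ i, ∑ j, k i j * (f t i * x t j) := by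
      simp only [dotProduct, Matrix.mulVec, Finset.mul_sum, hk]
      exact Finset.sum_congr rfl fun i _ => Finset.sum_congr rfl fun j _ => by ring
    simp only [mul_add, Finset.sum_add_distrib]
    rw [← h1, ← h2, hK.dotProduct_mulVec_comm (f t) (x t)]
    ring
  change IntervalIntegrable (fun t => 2 * (x t ⬝ᵥ K *ᵥ f t)) volume 0 T ∧
    _ = ∫ t in 0..T, 2 * (x t ⬝ᵥ K *ᵥ f t)
  simp only [hsum]
  refine ⟨IntervalIntegrable.finsetSum fun i => IntervalIntegrable.finsetSum fun j =>
    (hp i j).const_mul _, ?_⟩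
  rw [intervalIntegral.integral_finsetSum fun i _ => IntervalIntegrable.finsetSum fun j =>
    (hp i j).const_mul _]
  simp only [dotProduct, Matrix.mulVec, Finset.mul_sum, hk]
  refine Finset.sum_congr rfl fun i _ => ?_
  rw [intervalIntegral.integral_finsetSum fun j _ => (hp i j).const_mul _]
  refine Finset.sum_congr rfl fun j _ => ?_
  rw [intervalIntegral.integral_const_mul, ← hpe]
  ring

theorem IsTrajectoryFromRest.continuousOn_output {H : LTISystem ι μ κ}
    {u : ℝ → EuclideanSpace ℝ μ} {x : ℝ → ι → ℝ} (hx : H.IsTrajectoryFromRest u x) :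
    ContinuousOn (H.output x) (Set.Ici 0) :=
  (PiLp.continuous_toLp 2 _).comp_continuousOn
    ((Continuous.matrix_mulVec continuous_const continuous_id).comp_continuousOn hx.1)

/-- The storage starts at zero and ends nonnegative, so integrating the dissipation inequality over
`[0, T]` allows it to be dropped. -/
theorem IsBoundedReal.integral_output_le {H : LTISystem ι μ κ} {K : Matrix ι ι ℝ} {γ : ℝ}
    (h : H.IsBoundedReal K γ) {u : ℝ → EuclideanSpace ℝ μ} {x : ℝ → ι → ℝ}
    (hx : H.IsTrajectoryFromRest u x) (hu : MemLp u 2 (volume.restrict (Set.Ici 0)))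
    {T : ℝ} (hT : 0 ≤ T) :
    ∫ t in 0..T, ‖H.output x t‖ ^ 2 ≤ γ ^ 2 * ∫ t in 0..T, ‖u t‖ ^ 2 := by
  obtain ⟨hi, he⟩ := hx.storage_eq hu h.posSemidef.isHermitian.isSymm hT
  have h0 := h.posSemidef.dotProduct_mulVec_nonneg (x T)
  rw [star_trivial, he] at h0
  have hy : IntervalIntegrable (fun t => ‖H.output x t‖ ^ 2) volume 0 T := by
    refine ContinuousOn.intervalIntegrable ?_
    rw [Set.uIcc_of_le hT]
    exact (hx.continuousOn_output.norm.pow 2).mono Set.Icc_subset_Ici_self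
  have hui : IntervalIntegrable (fun t => ‖u t‖ ^ 2) volume 0 T :=
    (intervalIntegrable_iff_integrableOn_Icc_of_le hT).2 (hu.integrableOn_norm_sq T)
  have hle : ∫ t in 0..T, (2 * (x t ⬝ᵥ K *ᵥ (H.A *ᵥ x t + H.B *ᵥ (u t).ofLp)) +
      ‖H.output x t‖ ^ 2) ≤ ∫ t in 0..T, γ ^ 2 * ‖u t‖ ^ 2 := by
    refine intervalIntegral.integral_mono_on hT (hi.add hy) (hui.const_mul _) fun t _ => ?_
    have := h.dissipation (x t) (u t).ofLp
    rw [output, norm_toLp_sq_real]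
    rwa [← norm_toLp_sq_real (u t).ofLp] at this
  rw [intervalIntegral.integral_add hi hy,
    intervalIntegral.integral_const_mul (γ ^ 2)] at hle
  linarith

/-- The gain from square integrable inputs to outputs, from rest, is at most `γ`. -/
def L2GainLE (H : LTISystem ι μ κ) (γ : ℝ) : Prop :=
  ∀ (u : ℝ → EuclideanSpace ℝ μ) (x : ℝ → ι → ℝ), MemLp u 2 (volume.restrict (Set.Ici 0)) →
    H.IsTrajectoryFromRest u x → signalNorm (H.output x) ≤ ENNReal.ofReal γ * signalNorm u

end LTISystem

theorem signalNorm_eq (e : ℝ → EuclideanSpace ℝ κ) :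
    signalNorm e = (∫⁻ t in Set.Ici 0, ‖e t‖ₑ ^ (2 : ℝ)) ^ (1 / 2 : ℝ) := by
  rw [signalNorm, eLpNorm_eq_lintegral_rpow_enorm_toReal (by norm_num) (by norm_num)]
  simp

theorem lintegral_enorm_Icc_eq {e : ℝ → EuclideanSpace ℝ κ} {T : ℝ} (hT : 0 ≤ T)
    (he : IntegrableOn (fun t => ‖e t‖ ^ 2) (Set.Icc 0 T)) :
    ∫⁻ t in Set.Icc 0 T, ‖e t‖ₑ ^ (2 : ℝ) = ENNReal.ofReal (∫ t in 0..T, ‖e t‖ ^ 2) := by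
  rw [intervalIntegral.integral_of_le hT, ← integral_Icc_eq_integral_Ioc,
    ofReal_integral_eq_lintegral_ofReal he (Filter.Eventually.of_forall fun t => by positivity)]
  refine lintegral_congr fun t => ?_
  rw [ENNReal.ofReal_pow (norm_nonneg _), ofReal_norm]
  norm_cast

theorem lintegral_Ici_le_of_forall_Icc {f : ℝ → ℝ≥0∞} {c : ℝ≥0∞}
    (h : ∀ T : ℝ, 0 ≤ T → ∫⁻ t in Set.Icc 0 T, f t ≤ c) : ∫⁻ t in Set.Ici 0, f t ≤ c := by
  have hU : Set.Ici (0 : ℝ) = ⋃ n : ℕ, Set.Icc (0 : ℝ) n := by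
    ext t
    simp only [Set.mem_Ici, Set.mem_iUnion, Set.mem_Icc]
    exact ⟨fun ht => (exists_nat_ge t).imp fun n hn => ⟨ht, hn⟩, fun ⟨_, hn⟩ => hn.1⟩
  have hmono : Monotone fun n : ℕ => Set.Icc (0 : ℝ) n := fun a b hab =>
    Set.Icc_subset_Icc_right (by exact_mod_cast hab)
  rw [hU, setLIntegral_iUnion_of_directed _ hmono.directed_le]
  exact iSup_le fun n => h n n.cast_nonneg

namespace LTISystem

theorem IsBoundedReal.l2GainLE {H : LTISystem ι μ κ} {K : Matrix ι ι ℝ} {γ : ℝ}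
    (h : H.IsBoundedReal K γ) (hγ : 0 ≤ γ) : H.L2GainLE γ := by
  intro u x hu hx
  have key : ∫⁻ t in Set.Ici 0, ‖H.output x t‖ₑ ^ (2 : ℝ) ≤
      ENNReal.ofReal γ ^ (2 : ℝ) * ∫⁻ t in Set.Ici 0, ‖u t‖ₑ ^ (2 : ℝ) := by
    refine lintegral_Ici_le_of_forall_Icc fun T hT => ?_
    have hy : IntegrableOn (fun t => ‖H.output x t‖ ^ 2) (Set.Icc 0 T) :=
      ((hx.continuousOn_output.norm.pow 2).mono Set.Icc_subset_Ici_self).integrableOn_Icc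
    refine le_trans ?_ (mul_le_mul_right
      (lintegral_mono_set (Set.Icc_subset_Ici_self : Set.Icc 0 T ⊆ Set.Ici 0)) _)
    rw [lintegral_enorm_Icc_eq hT hy, lintegral_enorm_Icc_eq hT (hu.integrableOn_norm_sq T),
      ENNReal.ofReal_rpow_of_nonneg hγ (by norm_num), ← ENNReal.ofReal_mul (by positivity)]
    refine ENNReal.ofReal_le_ofReal ?_
    have := h.integral_output_le hx hu hT
    exact_mod_cast this
  rw [signalNorm_eq, signalNorm_eq]
  refine (ENNReal.rpow_le_rpow key (by norm_num)).trans_eq ?_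
  rw [ENNReal.mul_rpow_of_nonneg _ _ (by norm_num), ← ENNReal.rpow_mul]
  norm_num

theorem L2GainLE.inducedL2Norm_le {H : LTISystem ι μ κ} {γ : ℝ} (h : H.L2GainLE γ) :
    H.inducedL2Norm ≤ ENNReal.ofReal γ :=
  iSup_le fun u => iSup_le fun x => iSup_le fun hu => iSup_le fun hne => iSup_le fun hx =>
    (ENNReal.div_le_iff hne hu.2.ne).2 (h u x hu hx)

end LTISystem

end TimeDomain

/-! ### Existence of trajectories, the triangle inequality and coordinate changes -/

section Existence

variable {ι ι' ι'' μ κ : Type*} [Fintype ι] [Fintype ι'] [Fintype ι''] [Fintype μ] [Fintype κ]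

/-- A fundamental matrix of `ẋ = A x` together with its inverse. -/
theorem exists_fundamentalMatrix [DecidableEq ι] (A : Matrix ι ι ℝ) :
    ∃ Φ Ψ : ℝ → Matrix ι ι ℝ, (∀ i j, Continuous fun t => Ψ t i j) ∧
      (∀ t i j, HasDerivAt (fun τ => Φ τ i j) ((A * Φ t) i j) t) ∧ ∀ t, Φ t * Ψ t = 1 := by
  let _ : NormedRing (Matrix ι ι ℝ) := Matrix.linftyOpNormedRing
  let _ : NormedAlgebra ℝ (Matrix ι ι ℝ) := Matrix.linftyOpNormedAlgebra
  have hd (t : ℝ) : HasDerivAt (fun τ : ℝ => NormedSpace.exp (τ • A))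
      (A * NormedSpace.exp (t • A)) t := hasDerivAt_exp_smul_const' A t
  have hentry (i j : ι) : Continuous fun M : Matrix ι ι ℝ => M i j :=
    LinearMap.continuous_of_finiteDimensional (Matrix.entryLinearMap ℝ ℝ i j)
  refine ⟨fun t => NormedSpace.exp (t • A), fun t => NormedSpace.exp ((-t) • A),
    fun i j => ?_, fun t i j => ?_, fun t => ?_⟩
  · have hc : Continuous fun τ : ℝ => NormedSpace.exp (τ • A) :=
      continuous_iff_continuousAt.2 fun t => (hd t).continuousAt
    exact (hentry i j).comp (hc.comp continuous_neg)
  · exact ((LinearMap.toContinuousLinearMap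
      (Matrix.entryLinearMap ℝ ℝ i j : Matrix ι ι ℝ →ₗ[ℝ] ℝ)).hasFDerivAt).comp_hasDerivAt t (hd t)
  · beta_reduce
    rw [← Matrix.exp_add_of_commute, neg_smul, add_neg_cancel, NormedSpace.exp_zero]
    rw [neg_smul]
    exact (Commute.refl _).neg_right

/-- Product rule for a `C¹` function and an indefinite integral. -/
theorem mul_integral_eq {φ φ' g : ℝ → ℝ} {T : ℝ} (hφ : ∀ t, HasDerivAt φ (φ' t) t)
    (hφ' : Continuous φ') (hg : IntervalIntegrable g volume 0 T) :
    φ T * (∫ t in 0..T, g t) =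
      ∫ t in 0..T, (φ' t * (∫ τ in 0..t, g τ) + φ t * g t) := by
  have hF (t : ℝ) : ∫ τ in 0..t, φ' τ = φ t - φ 0 :=
    intervalIntegral.integral_eq_sub_of_hasDerivAt (fun x _ => hφ x) (hφ'.intervalIntegrable _ _)
  have h := integral_mul_integral_eq (hφ'.intervalIntegrable 0 T) hg
  simp only [hF] at h
  have hcφ : Continuous φ := continuous_iff_continuousAt.2 fun t => (hφ t).continuousAt
  have hG := continuousOn_integral hg
  have i1 : IntervalIntegrable (fun t => φ' t * (∫ τ in 0..t, g τ) + (φ t - φ 0) * g t)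
      volume 0 T :=
    ((hφ'.continuousOn.mul hG).intervalIntegrable).add
      (hg.continuousOn_mul ((hcφ.sub continuous_const).continuousOn))
  have e : (fun t => φ' t * (∫ τ in 0..t, g τ) + φ t * g t) = fun t =>
      (φ' t * (∫ τ in 0..t, g τ) + (φ t - φ 0) * g t) + φ 0 * g t := by
    ext t; ring
  rw [e, intervalIntegral.integral_add i1 (hg.const_mul _), ← h,
    intervalIntegral.integral_const_mul]
  ring

namespace LTISystem

theorem exists_isTrajectoryFromRest (H : LTISystem ι μ κ) {u : ℝ → EuclideanSpace ℝ μ}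
    (hu : MemLp u 2 (volume.restrict (Set.Ici 0))) : ∃ x, H.IsTrajectoryFromRest u x := by
  classical
  obtain ⟨Φ, Ψ, hΨ, hΦ, hΦΨ⟩ := exists_fundamentalMatrix H.A
  have hΦc (i j : ι) : Continuous fun t => Φ t i j :=
    continuous_iff_continuousAt.2 fun t => (hΦ t i j).continuousAt
  have hΦ'c (i j : ι) : Continuous fun t => (H.A * Φ t) i j := by
    simp only [Matrix.mul_apply]
    exact continuous_finsetSum _ fun k _ => continuous_const.mul (hΦc k j)
  set g : ℝ → ι → ℝ := fun t => Ψ t *ᵥ (H.B *ᵥ (u t).ofLp) with hg_def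
  have hb {T : ℝ} (hT : 0 ≤ T) (i : ι) :
      IntervalIntegrable (fun t => (H.B *ᵥ (u t).ofLp) i) volume 0 T :=
    IntervalIntegrable.finsetSum fun j => (hu.intervalIntegrable_apply hT j).const_mul (H.B i j)
  have hg {T : ℝ} (hT : 0 ≤ T) (j : ι) : IntervalIntegrable (fun t => g t j) volume 0 T :=
    IntervalIntegrable.finsetSum fun k => (hb hT k).continuousOn_mul (hΨ j k).continuousOn
  -- Variation of constants: `x = Φ ∫ Φ⁻¹ B u`.
  set x : ℝ → ι → ℝ := fun t i => ∑ j, Φ t i j * ∫ τ in 0..t, g τ j with hx_def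
  have hcI {T : ℝ} (hT : 0 ≤ T) (i : ι) : ContinuousOn (fun t => x t i) (Set.uIcc 0 T) :=
    continuousOn_finsetSum _ fun j _ => (hΦc i j).continuousOn.mul (continuousOn_integral (hg hT j))
  have hc : ContinuousOn x (Set.Ici 0) := by
    refine continuousOn_pi.2 fun i t ht => ?_
    rw [Set.mem_Ici] at ht
    -- The interval `[0, t + 1]` keeps `t` away from the right endpoint.
    have h0 := hcI (by linarith : (0 : ℝ) ≤ t + 1) i
    rw [Set.uIcc_of_le (by linarith)] at h0
    refine (h0 t ⟨ht, by linarith⟩).mono_of_mem_nhdsWithin ?_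
    refine mem_nhdsWithin.2 ⟨Set.Iio (t + 1), isOpen_Iio, by simp, fun s hs => ⟨hs.2, hs.1.le⟩⟩
  have hΦg (t : ℝ) (i : ι) : ∑ j, Φ t i j * g t j = (H.B *ᵥ (u t).ofLp) i := by
    change (Φ t *ᵥ (Ψ t *ᵥ (H.B *ᵥ (u t).ofLp))) i = _
    rw [Matrix.mulVec_mulVec, hΦΨ, Matrix.one_mulVec]
  have hΦ'x (t : ℝ) (i : ι) : ∑ j, (H.A * Φ t) i j * (∫ τ in 0..t, g τ j) = (H.A *ᵥ x t) i := by
    change ((H.A * Φ t) *ᵥ fun j => ∫ τ in 0..t, g τ j) i = (H.A *ᵥ (Φ t *ᵥ _)) i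
    rw [Matrix.mulVec_mulVec]
  have hf {T : ℝ} (hT : 0 ≤ T) (i : ι) :
      IntervalIntegrable (fun t => (H.A *ᵥ x t + H.B *ᵥ (u t).ofLp) i) volume 0 T := by
    refine IntervalIntegrable.add ?_ (hb hT i)
    exact IntervalIntegrable.finsetSum fun j =>
      (continuousOn_const.mul (hcI hT j)).intervalIntegrable
  refine ⟨x, hc, fun T hT => ?_⟩
  ext i
  rw [intervalIntegral_apply hT (hf hT) i]
  have hterm (j : ι) := mul_integral_eq (fun t => hΦ t i j) (hΦ'c i j) (hg hT j)
  change ∑ j, Φ T i j * ∫ τ in 0..T, g τ j = _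
  rw [Finset.sum_congr rfl fun j _ => hterm j,
    ← intervalIntegral.integral_finsetSum fun j _ => ?_]
  · refine intervalIntegral.integral_congr fun t _ => ?_
    simp only [Finset.sum_add_distrib, hΦg, hΦ'x, Pi.add_apply]
  · exact (((hΦ'c i j).continuousOn.mul (continuousOn_integral (hg hT j))).intervalIntegrable).add
      ((hg hT j).continuousOn_mul (hΦc i j).continuousOn)

theorem isTrajectoryFromRest_sub_iff (G : LTISystem ι μ κ) (H : LTISystem ι' μ κ)
    {u : ℝ → EuclideanSpace ℝ μ} (hu : MemLp u 2 (volume.restrict (Set.Ici 0)))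
    (x : ℝ → ι → ℝ) (x' : ℝ → ι' → ℝ) :
    (G.sub H).IsTrajectoryFromRest u (fun t => Sum.elim (x t) (x' t)) ↔
      G.IsTrajectoryFromRest u x ∧ H.IsTrajectoryFromRest u x' := by
  constructor
  · intro h
    refine ⟨⟨?_, fun T hT => ?_⟩, ⟨?_, fun T hT => ?_⟩⟩
    · exact continuousOn_pi.2 fun i => h.continuousOn_apply (Sum.inl i)
    · ext i
      have h1 := h.apply_eq hu hT (Sum.inl i)
      have h2 (i : ι) := h.intervalIntegrable hu hT (Sum.inl i)
      simp only [sub_vectorField, Sum.elim_inl] at h1 h2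
      rw [h1, intervalIntegral_apply hT h2]
    · exact continuousOn_pi.2 fun i => h.continuousOn_apply (Sum.inr i)
    · ext i
      have h1 := h.apply_eq hu hT (Sum.inr i)
      have h2 (i : ι') := h.intervalIntegrable hu hT (Sum.inr i)
      simp only [sub_vectorField, Sum.elim_inr] at h1 h2
      rw [h1, intervalIntegral_apply hT h2]
  · rintro ⟨hx, hx'⟩
    refine ⟨continuousOn_pi.2 ?_, fun T hT => ?_⟩
    · rintro (i | i)
      exacts [hx.continuousOn_apply i, hx'.continuousOn_apply i]
    · have h2 (i : ι ⊕ ι') : IntervalIntegrable (fun t =>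
          Sum.elim (G.A *ᵥ x t + G.B *ᵥ (u t).ofLp) (H.A *ᵥ x' t + H.B *ᵥ (u t).ofLp) i)
          volume 0 T := by
        rcases i with i | i
        exacts [hx.intervalIntegrable hu hT i, hx'.intervalIntegrable hu hT i]
      simp only [sub_vectorField]
      ext i
      rw [intervalIntegral_apply hT h2]
      rcases i with i | i
      exacts [hx.apply_eq hu hT i, hx'.apply_eq hu hT i]

theorem output_sub (G : LTISystem ι μ κ) (H : LTISystem ι' μ κ)
    (x : ℝ → ι → ℝ) (x' : ℝ → ι' → ℝ) :
    (G.sub H).output (fun t => Sum.elim (x t) (x' t)) = G.output x - H.output x' := by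
  ext t : 1
  simp only [output, sub_C_mulVec, Pi.sub_apply, WithLp.toLp_sub]

theorem L2GainLE.sub_trans {G : LTISystem ι μ κ} {H : LTISystem ι' μ κ} {K : LTISystem ι'' μ κ}
    {γ δ : ℝ} (hγ : 0 ≤ γ) (hδ : 0 ≤ δ) (hGH : (G.sub H).L2GainLE γ)
    (hHK : (H.sub K).L2GainLE δ) : (G.sub K).L2GainLE (γ + δ) := by
  intro u ξ hu hξ
  obtain ⟨x, z, rfl⟩ : ∃ (x : ℝ → ι → ℝ) (z : ℝ → ι'' → ℝ), ξ = fun t => Sum.elim (x t) (z t) :=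
    ⟨fun t => ξ t ∘ Sum.inl, fun t => ξ t ∘ Sum.inr, by simp⟩
  rw [isTrajectoryFromRest_sub_iff _ _ hu] at hξ
  obtain ⟨y, hy⟩ := H.exists_isTrajectoryFromRest hu
  have h1 := hGH u _ hu ((isTrajectoryFromRest_sub_iff G H hu x y).2 ⟨hξ.1, hy⟩)
  have h2 := hHK u _ hu ((isTrajectoryFromRest_sub_iff H K hu y z).2 ⟨hy, hξ.2⟩)
  rw [output_sub] at h1 h2 ⊢
  have mx := hξ.1.continuousOn_output.aestronglyMeasurable (μ := volume) measurableSet_Ici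
  have my := hy.continuousOn_output.aestronglyMeasurable (μ := volume) measurableSet_Ici
  have mz := hξ.2.continuousOn_output.aestronglyMeasurable (μ := volume) measurableSet_Ici
  rw [← sub_add_sub_cancel _ (H.output y), ENNReal.ofReal_add hγ hδ, add_mul]
  exact (eLpNorm_add_le (mx.sub my) (my.sub mz) (by norm_num)).trans (add_le_add h1 h2)

theorem mulVec_integral {M : Matrix ι' ι ℝ} {f : ℝ → ι → ℝ} {T : ℝ} (hT : 0 ≤ T)
    (hf : ∀ i, IntervalIntegrable (fun t => f t i) volume 0 T) :
    M *ᵥ (∫ t in 0..T, f t) = ∫ t in 0..T, M *ᵥ f t := by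
  have hi (k : ι') (i : ι) : IntervalIntegrable (fun t => M k i * f t i) volume 0 T :=
    (hf i).const_mul _
  ext k
  have hMf (k : ι') : IntervalIntegrable (fun t => (M *ᵥ f t) k) volume 0 T :=
    IntervalIntegrable.finsetSum (hi k)
  rw [intervalIntegral_apply hT hMf]
  change ∑ i, M k i * (∫ t in 0..T, f t) i = ∫ t in 0..T, ∑ i, M k i * f t i
  rw [intervalIntegral.integral_finsetSum fun i _ => hi k i]
  refine Finset.sum_congr rfl fun i _ => ?_
  rw [intervalIntegral.integral_const_mul, intervalIntegral_apply hT hf]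

theorem L2GainLE.of_changeCoords [DecidableEq ι] {G : LTISystem ι μ κ} {H : LTISystem ι' μ κ}
    {W : Matrix ι ι ℝ} (hW : IsUnit W) {γ : ℝ}
    (h : ((G.changeCoords W).sub H).L2GainLE γ) : (G.sub H).L2GainLE γ := by
  intro u ξ hu hξ
  obtain ⟨x, z, rfl⟩ : ∃ (x : ℝ → ι → ℝ) (z : ℝ → ι' → ℝ), ξ = fun t => Sum.elim (x t) (z t) :=
    ⟨fun t => ξ t ∘ Sum.inl, fun t => ξ t ∘ Sum.inr, by simp⟩
  rw [isTrajectoryFromRest_sub_iff _ _ hu] at hξ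
  have hWW : W * W⁻¹ = 1 := Matrix.mul_nonsing_inv W ((Matrix.isUnit_iff_isUnit_det W).1 hW)
  have hx (v : ι → ℝ) : W *ᵥ (W⁻¹ *ᵥ v) = v := by
    rw [Matrix.mulVec_mulVec, hWW, Matrix.one_mulVec]
  have h1 : (G.changeCoords W).IsTrajectoryFromRest u (fun t => W⁻¹ *ᵥ x t) := by
    refine ⟨(Continuous.matrix_mulVec continuous_const continuous_id).comp_continuousOn hξ.1.1,
      fun T hT => ?_⟩
    beta_reduce
    conv_lhs => rw [hξ.1.2 T hT]
    rw [mulVec_integral hT fun i => hξ.1.intervalIntegrable hu hT i]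
    simp only [changeCoords, ← Matrix.mulVec_mulVec, hx, Matrix.mulVec_add]
  have h2 := h u _ hu ((isTrajectoryFromRest_sub_iff _ H hu _ z).2 ⟨h1, hξ.2⟩)
  rw [output_sub] at h2 ⊢
  have ho : (G.changeCoords W).output (fun t => W⁻¹ *ᵥ x t) = G.output x := by
    ext t : 1
    simp only [output, changeCoords, ← Matrix.mulVec_mulVec, hx]
  rwa [ho] at h2

end LTISystem

end Existence

/-! ### Induction over the deleted states -/

section ErrorBound

open LTISystem

variable {μ κ : Type*} [Fintype μ] [Fintype κ]

/-- Error bound for truncating a realization that is balanced in the sense of the two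
dissipation inequalities. -/
theorem truncation_gain_le {n : ℕ} (k : ℕ) (hk : k ≤ n) (G : LTISystem (Fin n) μ κ)
    {Q P : Matrix (Fin n) (Fin n) ℝ} {σ : Fin n → ℝ} {α : ℝ} (hσ : ∀ i, 0 < σ i)
    (hQ₀ : Q.PosDef) (hP₀ : P.PosDef)
    (hQ : G.ObsDissipative Q σ α) (hP : G.ContrDissipative P σ⁻¹ α) :
    (G.sub (G.truncate k hk)).FreqGainLE
        (2 * ∑ j ∈ Finset.univ.filter (fun j : Fin n => k ≤ (j : ℕ)), σ j) ∧
      (G.sub (G.truncate k hk)).L2GainLE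
        (2 * ∑ j ∈ Finset.univ.filter (fun j : Fin n => k ≤ (j : ℕ)), σ j) := by
  induction n with
  | zero =>
    obtain rfl : k = 0 := Nat.le_zero.1 hk
    obtain ⟨K, hK⟩ := isBoundedReal_sub_self hQ₀.posSemidef hQ
    simpa using! And.intro (hK.freqGainLE le_rfl) (hK.l2GainLE le_rfl)
  | succ n ih =>
    rcases hk.eq_or_lt with rfl | hlt
    · obtain ⟨K, hK⟩ := isBoundedReal_sub_self hQ₀.posSemidef hQ
      have hs : ∑ j ∈ Finset.univ.filter (fun j : Fin (n + 1) => n + 1 ≤ (j : ℕ)), σ j = 0 := by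
        rw [Finset.filter_false_of_mem fun j _ => by have := j.2; omega, Finset.sum_empty]
      rw [hs, mul_zero]
      exact ⟨hK.freqGainLE le_rfl, hK.l2GainLE le_rfl⟩
    · have hkn : k ≤ n := Nat.lt_succ_iff.1 hlt
      have hs : 2 * ∑ j ∈ Finset.univ.filter (fun j : Fin (n + 1) => k ≤ (j : ℕ)), σ j =
          2 * σ (Fin.last n) +
            2 * ∑ j ∈ Finset.univ.filter (fun j : Fin n => k ≤ (j : ℕ)), (σ ∘ Fin.castSucc) j := by
        rw [Finset.sum_filter, Fin.sum_univ_castSucc, Finset.sum_filter]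
        simp [hkn]
        ring
      obtain ⟨K, hK⟩ := isBoundedReal_sub_truncate (hσ _) hQ₀.posSemidef hP₀.posSemidef hQ hP
      have hQ₁ := hQ₀.submatrix (Fin.castSucc_injective n)
      have hP₁ := hP₀.submatrix (Fin.castSucc_injective n)
      obtain ⟨h1, h2⟩ := ih hkn (G.truncate n n.le_succ) (fun i => hσ i.castSucc) hQ₁ hP₁
        hQ.truncate hP.truncate
      have hl : 0 ≤ 2 * σ (Fin.last n) := by have := hσ (Fin.last n); positivity
      have hr : 0 ≤ 2 * ∑ j ∈ Finset.univ.filter (fun j : Fin n => k ≤ (j : ℕ)), (σ ∘ Fin.castSucc) j :=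
        mul_nonneg zero_le_two (Finset.sum_nonneg fun j _ => (hσ j.castSucc).le)
      rw [hs]
      -- Truncating to `n` and then to `k` states is definitionally the truncation to `k`, so `h1`
      -- and `h2` apply unchanged.
      exact ⟨(hK.freqGainLE hl).sub_trans h1 fun s u hs =>
          hQ.truncate.exists_isExpResponse hQ₁ hs u,
        (hK.l2GainLE hl).sub_trans hl hr h2⟩

theorem inv_diagonal_of_pos {n : ℕ} {σ : Fin n → ℝ} (hσ : ∀ i, 0 < σ i) :
    (Matrix.diagonal σ)⁻¹ = Matrix.diagonal σ⁻¹ := by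
  refine Matrix.inv_eq_right_inv ?_
  rw [Matrix.diagonal_mul_diagonal, ← Matrix.diagonal_one]
  congr 1
  ext i
  exact mul_inv_cancel₀ (hσ i).ne'

end ErrorBound

/-- `G` is the given system, `G.changeCoords W` the balanced one, in which the two extended
Gramians have `S = T⁻¹ = diag(σ₁, …, σₙ)`. Coordinates are numbered from `0`, so `k ≤ j` picks
out `σ_{k+1}, …, σₙ`. -/
theorem theorem3 {n m q : ℕ} (G : LTISystem (Fin n) (Fin m) (Fin q))
    (hG : G.IsAsymptoticallyStable)
    (W : Matrix (Fin n) (Fin n) ℝ) (hW : IsUnit W)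
    (σ : Fin n → ℝ) (hσ : ∀ i, 0 < σ i)
    (Q P : Matrix (Fin n) (Fin n) ℝ) (α β : ℝ)
    (hQ : IsExtObsGramian (G.changeCoords W) Q (Matrix.diagonal σ) α)
    (hP : IsInvExtContrGramian (G.changeCoords W) P (Matrix.diagonal σ)⁻¹ β)
    (hαβ : α = β) (k : ℕ) (hk : k ≤ n) :
    (G.sub ((G.changeCoords W).truncate k hk)).hInfNorm ≤
        ENNReal.ofReal (2 * ∑ j ∈ Finset.univ.filter (fun j : Fin n => k ≤ (j : ℕ)), σ j) ∧
      (G.sub ((G.changeCoords W).truncate k hk)).inducedL2Norm ≤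
        ENNReal.ofReal (2 * ∑ j ∈ Finset.univ.filter (fun j : Fin n => k ≤ (j : ℕ)), σ j) := by
  subst hαβ
  rw [inv_diagonal_of_pos hσ] at hP
  obtain ⟨h1, h2⟩ := truncation_gain_le k hk (G.changeCoords W) hσ hQ.posDef hP.posDef
    hQ.obsDissipative hP.contrDissipative
  have h0 : 0 ≤ 2 * ∑ j ∈ Finset.univ.filter (fun j : Fin n => k ≤ (j : ℕ)), σ j :=
    mul_nonneg zero_le_two (Finset.sum_nonneg fun j _ => (hσ j).le)
  exact ⟨(h1.of_changeCoords hW).hInfNorm_le h0, (h2.of_changeCoords hW).inducedL2Norm_le⟩
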